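/- Let $\mathcal X$ be a measurable space and $P$ a probability distribution on $\mathcal X\times\mathbb R$. Let $\mathcal A$ be a symmetric regression algorithm: for every $k\ge 0$ it maps a data set $((x_1,y_1),\dots,(x_k,y_k))\in(\mathcal X\times\mathbb R)^k$ to a function $\mathcal X\to\mathbb R$, does not depend on the order of the data points, and its fitted value is jointly measurable in the data set and the test feature. Let $\alpha\in[0,1]$, $n\ge1$, and let $\mathcal D_n=((X_1,Y_1),\dots,(X_n,Y_n))$ be i.i.d. from $P$. For $i\in[n]=\{1,\dots,n\}$ let $\widehat\mu_{-i}$ be the model fitted by $\mathcal A$ to $\mathcal D_n$ without its $i$th point, and $R_i=|Y_i-\widehat\mu_{-i}(X_i)|$. The (uninflated) jackknife+ interval is \[\widehat C_n^{\mathrm{J+}}(x)=\Big[-\mathrm{Quantile}\big(\{-\widehat\mu_{-i}(x)+R_i\}_{i\in[n]};(1-\alpha)(1+\tfrac1n)\big),\ \mathrm{Quantile}\big(\{\widehat\mu_{-i}(x)+R_i\}_{i\in[n]};(1-\alpha)(1+\tfrac1n)\big)\Big],\] where $\mathrm{Quantile}(\{v_i\}_{i\in[n]};\tau)=\inf\{t\in\mathbb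 R:\frac1n\#\{i:v_i\le t\}\ge\tau\}\in[-\infty,\infty]$ (so $+\infty$ if $\tau>1$), and $[a,b]$ denotes $\{y\in\mathbb R : a\le y\le b\}$, which is empty if $a>b$. Its training-conditional miscoverage rate is $\alpha_P^{\mathrm{J+}}(\mathcal D_n)=\mathbb P\{Y\notin\widehat C_n^{\mathrm{J+}}(X)\mid\mathcal D_n\}$, where $(X,Y)\sim P$ is independent of $\mathcal D_n$. For $m,k\ge0$ let \[\beta^{\mathrm{out}}_{m,k}=\mathbb E\big[|\widehat\mu_k(X)-\widehat\mu_{k+m}(X)|\big]\in[0,\infty],\] where $\widehat\mu_k$ and $\widehat\mu_{k+m}$ are fitted by $\mathcal A$ to $(X_1,Y_1),\dots,(X_k,Y_k)$ and to $(X_1,Y_1),\dots,(X_{k+m},Y_{k+m})$ respectively, and $(X_1,Y_1),\dots,(X_{k+m},Y_{k+m}),(X,Y)$ are i.i.d. from $P$. Assume that the conditional distribution of $Y$ given $X$ under $P$ has a density $f_{Y|X}(y\mid x)$ with respect to Lebesgue measure, and let $B_{\mathrm{dens}}=\mathbb E\big[\sup_{y\in\mathbb R}f_{Y|X}(y\mid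 X)\big]\in[0,\infty]$. Then for every $m\ge1$ and every $\delta\in(0,1)$, \[\mathbb P\Big\{\alpha_P^{\mathrm{J+}}(\mathcal D_n)<\alpha+3\sqrt{\tfrac{\log(1/\delta)}{2\min\{n,m\}}}+4\sqrt[4]{2B_{\mathrm{dens}}\cdot\beta^{\mathrm{out}}_{m,n-1}}\Big\}\ \ge\ 1-3\delta-\sqrt[4]{2B_{\mathrm{dens}}\cdot\beta^{\mathrm{out}}_{m,n-1}},\] where the probability is over $\mathcal D_n$ (with the convention $\infty\cdot0=0$; the claim is trivial if the product is infinite). -/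

import Mathlib

open MeasureTheory ProbabilityTheory
open scoped ENNReal

noncomputable section

/-- A (nonrandom) regression algorithm on the feature space `𝓧`: for each sample size `n`, it turns
a data set of `n` points `(X, Y) ∈ 𝓧 × ℝ` into a fitted regression function `𝓧 → ℝ`.
The fitted value is measurable as a function of the data set and the test feature together; in
particular each fitted function is measurable, and all the probabilities below make sense. -/
structure RegressionAlgorithm (𝓧 : Type*) [MeasurableSpace 𝓧] where
  fit : (n : ℕ) → (Fin n → 𝓧 × ℝ) → 𝓧 → ℝ
  measurable_fit : ∀ n : ℕ, Measurable fun p : (Fin n → 𝓧 × ℝ) × 𝓧 => fit n p.1 p.2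

/-- The algorithm does not depend on the order of the training points. -/
def RegressionAlgorithm.IsSymmetric {𝓧 : Type*} [MeasurableSpace 𝓧]
    (A : RegressionAlgorithm 𝓧) : Prop :=
  ∀ (n : ℕ) (π : Equiv.Perm (Fin n)) (d : Fin n → 𝓧 × ℝ), A.fit n (d ∘ π) = A.fit n d

/-- The data set `d` with its `i`-th point removed. -/
def leaveOneOut {Z : Type*} : {n : ℕ} → (Fin n → Z) → Fin n → (Fin (n - 1) → Z)
  | 0, _, i => i.elim0
  | _ + 1, d, i => i.removeNth d

/-- The `τ`-quantile of the list `v 0, …, v (n-1)`, i.e. the infimum of all real `t` such that the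
proportion of indices `i` with `v i ≤ t` is at least `τ`. The infimum is taken in the extended
reals, so the quantile is `+∞` for `τ > 1` and `-∞` for `τ ≤ 0`. -/
def empiricalQuantile {n : ℕ} (v : Fin n → ℝ) (τ : ℝ) : EReal :=
  sInf (Real.toEReal '' {t : ℝ | τ ≤ ((Finset.univ.filter fun i => v i ≤ t).card : ℝ) / n})

namespace RegressionAlgorithm

variable {𝓧 : Type*} [MeasurableSpace 𝓧]

/-- The leave-one-out model, fitted to the data set `d` without its `i`-th point. -/
def looModel (A : RegressionAlgorithm 𝓧) {n : ℕ} (d : Fin n → 𝓧 × ℝ) (i : Fin n) : 𝓧 → ℝ :=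
  A.fit (n - 1) (leaveOneOut d i)

/-- The `i`-th leave-one-out residual. -/
def looResidual (A : RegressionAlgorithm 𝓧) {n : ℕ} (d : Fin n → 𝓧 × ℝ) (i : Fin n) : ℝ :=
  |(d i).2 - A.looModel d i (d i).1|

/-- The (uninflated) jackknife+ prediction interval at the feature value `x`, for the training data
`d` and the target miscoverage level `α`. It is empty if its lower end exceeds its upper end. -/
def jackknifePlus (A : RegressionAlgorithm 𝓧) (α : ℝ) {n : ℕ} (d : Fin n → 𝓧 × ℝ) (x : 𝓧) :
    Set ℝ :=
  {y : ℝ |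
    -empiricalQuantile (fun i => -A.looModel d i x + A.looResidual d i)
        ((1 - α) * (1 + 1 / (n : ℝ))) ≤ (y : EReal) ∧
    (y : EReal) ≤ empiricalQuantile (fun i => A.looModel d i x + A.looResidual d i)
        ((1 - α) * (1 + 1 / (n : ℝ)))}

/-- The training-conditional miscoverage rate of jackknife+: the probability, over a new point
`(X, Y) ∼ P` drawn independently of the training data `d`, that `Y` misses the interval at `X`. -/
def jackknifePlusMiscoverage (A : RegressionAlgorithm 𝓧) (P : Measure (𝓧 × ℝ)) (α : ℝ) {n : ℕ}
    (d : Fin n → 𝓧 × ℝ) : ℝ≥0∞ :=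
  P {z : 𝓧 × ℝ | z.2 ∉ A.jackknifePlus α d z.1}

/-- Out-of-sample `m`-stability: the expected absolute difference (in `[0, ∞]`) at an independent
test point between the predictions of the model fitted to the first `n` points and of the model
fitted to all points of a data set of size `n + m`, all points being i.i.d. from `P`. -/
def outStability (A : RegressionAlgorithm 𝓧) (P : Measure (𝓧 × ℝ)) (m n : ℕ) : ℝ≥0∞ :=
  ∫⁻ p : (Fin (n + m) → 𝓧 × ℝ) × (𝓧 × ℝ),
    ENNReal.ofReal |A.fit n (fun i => p.1 (Fin.castAdd m i)) p.2.1 - A.fit (n + m) p.1 p.2.1|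
    ∂((Measure.pi fun _ : Fin (n + m) => P).prod P)

end RegressionAlgorithm

/-- `f x y` is a conditional density `f_{Y|X}(y | x)`, with respect to Lebesgue measure, of `Y`
given `X = x` when `(X, Y) ∼ P`. -/
def IsCondDensity {𝓧 : Type*} [MeasurableSpace 𝓧] (P : Measure (𝓧 × ℝ)) [IsFiniteMeasure P]
    (f : 𝓧 → ℝ → ℝ≥0∞) : Prop :=
  Measurable (Function.uncurry f) ∧
    ∀ᵐ x ∂P.fst, P.condKernel x = (volume : Measure ℝ).withDensity (f x)

/-- The expectation, over the marginal distribution of `X`, of the supremum over `y` of the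
conditional density (a value in `[0, ∞]`). -/
def densBound {𝓧 : Type*} [MeasurableSpace 𝓧] (P : Measure (𝓧 × ℝ)) (f : 𝓧 → ℝ → ℝ≥0∞) : ℝ≥0∞ :=
  ∫⁻ x, ⨆ y : ℝ, f x y ∂P.fst

end

/-! ### Concentration of the number of occurring events -/

/-! Write the training size as `n + 1`. Adjoin `m` independent test points and compare everything
with the leave-one-out residuals `r k` of the full sample of `n + m + 1` points. These are
exchangeable because the algorithm is symmetric. If the `i`-th training model errs at test point `j`
by more than `R_i + γ`, then normally `r` is larger at `j` than at `i`. An exception ("overtaking")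
forces one of two model changes to be visible: the `n`-point model without `i` must differ, at `i`
or at `j`, from the corresponding full-sample leave-one-out model, the two differences summing to
more than `γ`. Each has mean `β`, the stability coefficient, so Markov bounds the probability by
`2β/γ`.

A test point missed by the inflated interval has at least `(1 - α)(n + 2)` such training indices.
Hence it either has a high rank in `r` or takes part in many overtakings. Hoeffding's inequality for
sampling without replacement controls the ranks among training and test points, Markov controls the
overtakings, and Hoeffding for the i.i.d. test points, conditionally on the training data, passes
from the missed fraction to the miscoverage probability.

Removing the inflation costs at most `2γB`, with `B` the density bound: for fixed `x`, each end
contributes responses confined to length `γ`. With `s ^ 4 = 2Bβ` and, in the nondegenerate case, `γ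
= s / (2B)`, this cost is `s` and the overtaking probability is at most `2 s ^ 3`. The total is `α +
4s + 3e`, `e` being the Hoeffding deviation, with failure probability `3δ + s`. -/

lemma measurable_card_filter {Ω ι : Type*} [MeasurableSpace Ω] (s : Finset ι) (p : ι → Ω → Prop)
    [∀ i ω, Decidable (p i ω)] (hp : ∀ i, MeasurableSet {ω | p i ω}) :
    Measurable fun ω => ((s.filter fun i => p i ω).card : ℝ) := by
  have h : (fun ω => ((s.filter fun i => p i ω).card : ℝ)) =
      fun ω => ∑ i ∈ s, if p i ω then (1 : ℝ) else 0 := by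
    funext ω
    simp
  rw [h]
  exact Finset.measurable_sum _ fun i _ => Measurable.ite (hp i) measurable_const measurable_const

/-- Hoeffding's lemma for a Bernoulli variable. -/
lemma one_add_mul_exp_sub_one_le {p : ℝ} (hp0 : 0 ≤ p) (hp1 : p ≤ 1) (l : ℝ) :
    1 + p * (Real.exp l - 1) ≤ Real.exp (l * p + l ^ 2 / 8) := by
  let μ : Measure ℝ := ENNReal.ofReal p • Measure.dirac 1 + ENNReal.ofReal (1 - p) • Measure.dirac 0
  have hμ : IsProbabilityMeasure μ := ⟨by
    simp only [μ, Measure.coe_add, Measure.coe_smul, Pi.add_apply, Pi.smul_apply, measure_univ,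
      smul_eq_mul, mul_one]
    rw [← ENNReal.ofReal_add hp0 (by linarith)]
    simp⟩
  have hint : ∀ g : ℝ → ℝ, ∫ x, g x ∂μ = p * g 1 + (1 - p) * g 0 := by
    intro g
    have h1 : Integrable g (ENNReal.ofReal p • Measure.dirac (1 : ℝ)) :=
      (integrable_dirac (by simp)).smul_measure ENNReal.ofReal_ne_top
    have h0 : Integrable g (ENNReal.ofReal (1 - p) • Measure.dirac (0 : ℝ)) :=
      (integrable_dirac (by simp)).smul_measure ENNReal.ofReal_ne_top
    rw [integral_add_measure h1 h0, integral_smul_measure, integral_smul_measure, integral_dirac,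
      integral_dirac, ENNReal.toReal_ofReal hp0, ENNReal.toReal_ofReal (by linarith)]
    simp
  have hae : ∀ᵐ x ∂μ, (fun x : ℝ => x) x ∈ Set.Icc (0 : ℝ) 1 := by
    rw [ae_add_measure_iff]
    constructor <;> refine Measure.ae_smul_measure ?_ _ <;> rw [ae_dirac_eq] <;> simp
  have hsub := (hasSubgaussianMGF_of_mem_Icc (μ := μ) measurable_id.aemeasurable hae).mgf_le l
  rw [mgf, hint, hint] at hsub
  -- Undoes the centring of the sub-Gaussian bound.
  have h2 := mul_le_mul_of_nonneg_left hsub (Real.exp_pos (l * p)).le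
  rw [← Real.exp_add] at h2
  have e1 : Real.exp (l * p) * (p * Real.exp (l * (1 - (p * 1 + (1 - p) * 0)))
      + (1 - p) * Real.exp (l * (0 - (p * 1 + (1 - p) * 0)))) = 1 + p * (Real.exp l - 1) := by
    rw [mul_add, mul_left_comm, ← Real.exp_add, mul_left_comm, ← Real.exp_add]
    rw [show l * p + l * (1 - (p * 1 + (1 - p) * 0)) = l by ring,
      show l * p + l * (0 - (p * 1 + (1 - p) * 0)) = 0 by ring, Real.exp_zero]
    ring
  simp only [id] at h2
  rw [e1] at h2
  refine h2.trans (Real.exp_le_exp.2 ?_)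
  simp
  nlinarith

/-- Hoeffding's inequality for events whose joint probabilities are at most those of independent
events of probability `p`. -/
lemma measureReal_card_ge_le_exp {Ω ι : Type*} [MeasurableSpace Ω] (μ : Measure Ω)
    [IsProbabilityMeasure μ] (T : Finset ι) (W : ι → Set Ω)
    [∀ i ω, Decidable (ω ∈ W i)] (hW : ∀ i, MeasurableSet (W i)) {p : ℝ}
    (hp0 : 0 ≤ p) (hp1 : p ≤ 1) (h : ∀ S ⊆ T, μ.real (⋂ i ∈ S, W i) ≤ p ^ S.card)
    {e : ℝ} (he : 0 ≤ e) :
    μ.real {ω | T.card * (p + e) ≤ ((T.filter fun i => ω ∈ W i).card : ℝ)}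
      ≤ Real.exp (-2 * T.card * e ^ 2) := by
  -- Minimises the final exponent `-l e + l ^ 2 / 8`.
  set l : ℝ := 4 * e
  have hl : 0 ≤ l := by positivity
  set c : ℝ := Real.exp l - 1
  have hc : 0 ≤ c := by simpa [c] using hl
  -- The exponential is a product of factors `1 + c 1_{W i}`. Expanded over subsets, its
  -- coefficients are nonnegative since `l ≥ 0`, so upper bounds on joint probabilities suffice to
  -- dominate a binomial moment generating function.
  have hexp : ∀ ω, Real.exp (l * ((T.filter fun i => ω ∈ W i).card : ℝ)) =
      ∑ S ∈ T.powerset, c ^ S.card * (⋂ i ∈ S, W i).indicator (fun _ => (1 : ℝ)) ω := by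
    intro ω
    have h1 : Real.exp (l * ((T.filter fun i => ω ∈ W i).card : ℝ)) =
        ∏ i ∈ T, (1 + if ω ∈ W i then c else 0) := by
      rw [mul_comm, Real.exp_nat_mul, ← Finset.prod_const, Finset.prod_filter]
      refine Finset.prod_congr rfl fun i _ => ?_
      split_ifs <;> simp [c]
    rw [h1, Finset.prod_one_add]
    refine Finset.sum_congr rfl fun S _ => ?_
    by_cases hS : ω ∈ ⋂ i ∈ S, W i
    · rw [Set.indicator_of_mem hS, mul_one, ← Finset.prod_const]
      refine Finset.prod_congr rfl fun i hi => if_pos ?_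
      simp only [Set.mem_iInter] at hS
      exact hS i hi
    · rw [Set.indicator_of_notMem hS, mul_zero]
      simp only [Set.mem_iInter, not_forall] at hS
      obtain ⟨i, hi, hn⟩ := hS
      exact Finset.prod_eq_zero hi (if_neg hn)
  have hmeas : ∀ S : Finset ι, MeasurableSet (⋂ i ∈ S, W i) := fun S =>
    Finset.measurableSet_biInter S fun i _ => hW i
  have hi : ∀ S : Finset ι, Integrable
      (fun ω => c ^ S.card * (⋂ i ∈ S, W i).indicator (fun _ => (1 : ℝ)) ω) μ := fun S =>
    ((integrable_const (1 : ℝ)).indicator (hmeas S)).const_mul _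
  have hmgf : mgf (fun ω => ((T.filter fun i => ω ∈ W i).card : ℝ)) μ l
      ≤ Real.exp (l * p + l ^ 2 / 8) ^ T.card := by
    calc mgf (fun ω => ((T.filter fun i => ω ∈ W i).card : ℝ)) μ l
        = ∑ S ∈ T.powerset, c ^ S.card * μ.real (⋂ i ∈ S, W i) := by
          rw [mgf]
          simp_rw [hexp]
          rw [integral_finsetSum _ fun S _ => hi S]
          refine Finset.sum_congr rfl fun S _ => ?_
          rw [integral_const_mul, integral_indicator_const _ (hmeas S)]
          simp
      _ ≤ ∑ S ∈ T.powerset, (p * c) ^ S.card * 1 ^ (T.card - S.card) := by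
          refine Finset.sum_le_sum fun S hS => ?_
          rw [one_pow, mul_one, mul_pow, mul_comm (p ^ _)]
          exact mul_le_mul_of_nonneg_left (h S (Finset.mem_powerset.1 hS)) (by positivity)
      _ = (1 + p * c) ^ T.card := by rw [Finset.sum_pow_mul_eq_add_pow, add_comm]
      _ ≤ _ := pow_le_pow_left₀ (by positivity) (one_add_mul_exp_sub_one_le hp0 hp1 l) _
  have hint : Integrable
      (fun ω => Real.exp (l * ((T.filter fun i => ω ∈ W i).card : ℝ))) μ := by
    simp_rw [hexp]
    exact integrable_finsetSum _ fun S _ => hi S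
  refine (measure_ge_le_exp_mul_mgf _ hl hint).trans ?_
  refine (mul_le_mul_of_nonneg_left hmgf (Real.exp_pos _).le).trans ?_
  rw [← Real.exp_nat_mul, ← Real.exp_add, Real.exp_le_exp]
  apply le_of_eq
  simp only [l]
  ring

/-- Joint probabilities of exchangeable events, at most a fraction `p` of which occur. -/
lemma measureReal_biInter_le_pow {Ω ι : Type*} [MeasurableSpace Ω] [Fintype ι] [DecidableEq ι]
    (μ : Measure Ω) [IsProbabilityMeasure μ] (W : ι → Set Ω)
    [∀ i ω, Decidable (ω ∈ W i)] (hW : ∀ i, MeasurableSet (W i)) {p : ℝ}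
    (hp1 : p ≤ 1) (hcard : ∀ ω, ((Finset.univ.filter fun i => ω ∈ W i).card : ℝ)
      ≤ p * Fintype.card ι)
    (hexch : ∀ (S : Finset ι) (k k' : ι), k ∉ S → k' ∉ S →
      μ.real (⋂ i ∈ insert k S, W i) = μ.real (⋂ i ∈ insert k' S, W i)) (S : Finset ι) :
    μ.real (⋂ i ∈ S, W i) ≤ p ^ S.card := by
  induction S using Finset.induction_on with
  | empty => simp
  | insert k S hk ih =>
    have hm : ∀ S : Finset ι, MeasurableSet (⋂ i ∈ S, W i) := fun S =>
      Finset.measurableSet_biInter S fun i _ => hW i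
    have hι : 0 < Fintype.card ι := Fintype.card_pos_iff.2 ⟨k⟩
    obtain ⟨ω₀⟩ : Nonempty Ω := μ.nonempty_of_neZero
    have hp0 : 0 ≤ p := by
      have h := (Nat.cast_nonneg _).trans (hcard ω₀)
      have h2 : (0 : ℝ) < Fintype.card ι := by exact_mod_cast hι
      exact nonneg_of_mul_nonneg_left h h2
    have hlt : S.card < Fintype.card ι :=
      Finset.card_lt_univ_of_notMem hk
    -- Where all events of `S` occur, at most `p N - |S|` others do, `N` being the number of events.
    -- By exchangeability all summands are equal.
    have hsum : ∑ k' ∈ Sᶜ, μ.real (⋂ i ∈ insert k' S, W i)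
        ≤ (p * Fintype.card ι - S.card) * μ.real (⋂ i ∈ S, W i) := by
      have h1 : ∀ k', μ.real (⋂ i ∈ insert k' S, W i) =
          ∫ ω, (⋂ i ∈ insert k' S, W i).indicator (fun _ => (1 : ℝ)) ω ∂μ := by
        intro k'
        rw [integral_indicator_const _ (hm _)]
        simp
      have h2 : (p * Fintype.card ι - S.card) * μ.real (⋂ i ∈ S, W i) =
          ∫ ω, (⋂ i ∈ S, W i).indicator (fun _ => p * Fintype.card ι - S.card) ω ∂μ := by
        rw [integral_indicator_const _ (hm _), smul_eq_mul, mul_comm]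
      have hi : ∀ k', Integrable
          ((⋂ i ∈ insert k' S, W i).indicator (fun _ => (1 : ℝ))) μ := fun k' =>
        (integrable_const (1 : ℝ)).indicator (hm _)
      simp_rw [h1]
      rw [h2, ← integral_finsetSum _ fun k' _ => hi k']
      refine integral_mono (integrable_finsetSum _ fun k' _ => hi k')
        ((integrable_const _).indicator (hm S)) fun ω => ?_
      by_cases hω : ω ∈ ⋂ i ∈ S, W i
      · simp only [Set.indicator_of_mem hω]
        have hmem : ∀ i ∈ S, ω ∈ W i := by simpa using hω
        have h3 : ∑ k' ∈ Sᶜ, (⋂ i ∈ insert k' S, W i).indicator (fun _ => (1 : ℝ)) ω =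
            ((Sᶜ.filter fun i => ω ∈ W i).card : ℝ) := by
          rw [Finset.card_filter, Nat.cast_sum]
          refine Finset.sum_congr rfl fun k' _ => ?_
          by_cases hk' : ω ∈ W k'
          · rw [if_pos hk', Set.indicator_of_mem]
            · simp
            · simpa [hk'] using hmem
          · rw [if_neg hk', Set.indicator_of_notMem]
            · simp
            · simp [hk']
        have h4 : (Finset.univ.filter fun i => ω ∈ W i) = S ∪ (Sᶜ.filter fun i => ω ∈ W i) := by
          ext i
          by_cases hiS : i ∈ S
          · simp [hiS, hmem i hiS]
          · simp [hiS]
        have h5 : (Finset.univ.filter fun i => ω ∈ W i).card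
            = S.card + (Sᶜ.filter fun i => ω ∈ W i).card := by
          rw [h4, Finset.card_union_of_disjoint]
          exact Finset.disjoint_left.2 fun i hi h => by simp [hi] at h
        have h6 := hcard ω
        rw [h5] at h6
        push_cast at h6
        rw [h3]
        linarith
      · rw [Set.indicator_of_notMem hω]
        refine (Finset.sum_eq_zero fun k' _ => Set.indicator_of_notMem (fun h => hω ?_) _).le
        simp only [Set.mem_iInter, Finset.mem_insert] at h ⊢
        exact fun i hi => h i (Or.inr hi)
    have hconst : ∑ k' ∈ Sᶜ, μ.real (⋂ i ∈ insert k' S, W i) =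
        (Fintype.card ι - S.card : ℝ) * μ.real (⋂ i ∈ insert k S, W i) := by
      rw [Finset.sum_congr rfl fun k' hk' => hexch S k' k (by simpa using hk') hk,
        Finset.sum_const, Finset.card_compl, nsmul_eq_mul, Nat.cast_sub hlt.le]
    rw [hconst] at hsum
    rw [Finset.card_insert_of_notMem hk, pow_succ']
    have hpos : (0 : ℝ) < Fintype.card ι - S.card := by
      rw [sub_pos]; exact_mod_cast hlt
    have hμ : 0 ≤ μ.real (⋂ i ∈ S, W i) := measureReal_nonneg
    -- Sampling without replacement only helps: `(p N - |S|) / (N - |S|) ≤ p`, because `p ≤ 1`.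
    have h7 : (p * Fintype.card ι - S.card) ≤ (Fintype.card ι - S.card) * p := by
      nlinarith [(Nat.cast_nonneg S.card : (0 : ℝ) ≤ S.card)]
    refine le_of_mul_le_mul_left (hsum.trans ?_) hpos
    calc _ ≤ ((Fintype.card ι - S.card) * p) * μ.real (⋂ i ∈ S, W i) :=
          mul_le_mul_of_nonneg_right h7 hμ
      _ ≤ ((Fintype.card ι - S.card) * p) * p ^ S.card :=
          mul_le_mul_of_nonneg_left ih (by positivity)
      _ = _ := by ring

/-! ### Reindexing product measures -/

lemma measurePreserving_comp_equiv {Z ι κ : Type*} [MeasurableSpace Z] [Fintype ι] [Fintype κ]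
    (P : Measure Z) [SigmaFinite P] (σ : κ ≃ ι) :
    MeasurePreserving (fun w : ι → Z => w ∘ σ) (Measure.pi fun _ => P) (Measure.pi fun _ => P) :=
  measurePreserving_arrowCongr' (fun _ : ι => P) (fun _ : κ => P) σ.symm (MeasurableEquiv.refl Z)
    fun _ => MeasurePreserving.id P

lemma measurePreserving_comp_sum {Z ι κ κ' : Type*} [MeasurableSpace Z] [Fintype ι] [Fintype κ]
    [Fintype κ'] (P : Measure Z) [SigmaFinite P] (σ : κ ⊕ κ' ≃ ι) :
    MeasurePreserving (fun w : ι → Z => (w ∘ σ ∘ Sum.inl, w ∘ σ ∘ Sum.inr))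
      (Measure.pi fun _ => P) ((Measure.pi fun _ => P).prod (Measure.pi fun _ => P)) :=
  (measurePreserving_sumPiEquivProdPi fun _ : κ ⊕ κ' => P).comp (measurePreserving_comp_equiv P σ)

lemma measurePreserving_comp_succ {Z : Type*} [MeasurableSpace Z] {M : ℕ}
    (P : Measure Z) [SigmaFinite P] (σ : Equiv.Perm (Fin (M + 1))) :
    MeasurePreserving (fun w : Fin (M + 1) → Z => (w ∘ σ ∘ Fin.succ, w (σ 0)))
      (Measure.pi fun _ => P) ((Measure.pi fun _ => P).prod P) := by
  have h := (Measure.measurePreserving_swap (μ := P) (ν := Measure.pi fun _ : Fin M => P)).comp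
    ((measurePreserving_piFinSuccAbove (fun _ : Fin (M + 1) => P) 0).comp
      (measurePreserving_comp_equiv P σ))
  exact h

/-! ### Symmetric algorithms -/

namespace RegressionAlgorithm

variable {𝓧 : Type*} [MeasurableSpace 𝓧]

/-- Two injective enumerations of one set differ by a permutation. -/
lemma IsSymmetric.fit_comp_eq {A : RegressionAlgorithm 𝓧} (hA : A.IsSymmetric) {M : ℕ}
    {ι : Type*} {g h : Fin M → ι} (hg : g.Injective) (hh : h.Injective)
    (hgh : Set.range g = Set.range h) (w : ι → 𝓧 × ℝ) :
    A.fit M (w ∘ g) = A.fit M (w ∘ h) := by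
  let π : Equiv.Perm (Fin M) :=
    (Equiv.ofInjective h hh).trans ((Equiv.setCongr hgh.symm).trans (Equiv.ofInjective g hg).symm)
  have hπ : g ∘ π = h := by
    funext i
    have h1 := Equiv.apply_ofInjective_symm hg (Equiv.setCongr hgh.symm (Equiv.ofInjective h hh i))
    exact h1
  rw [← hπ, ← Function.comp_assoc, hA]

lemma IsSymmetric.looModel_eq {A : RegressionAlgorithm 𝓧} (hA : A.IsSymmetric) {M : ℕ}
    (w : Fin (M + 1) → 𝓧 × ℝ) {k : Fin (M + 1)} {h : Fin M → Fin (M + 1)} (hh : h.Injective)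
    (hk : Set.range h = {k}ᶜ) : A.looModel w k = A.fit M (w ∘ h) :=
  hA.fit_comp_eq (Fin.succAbove_right_injective (p := k)) hh
    (by rw [hk]; exact Fin.range_succAbove k) w

/-- The source of exchangeability: permuting the sample permutes its residuals. -/
lemma IsSymmetric.looResidual_comp {A : RegressionAlgorithm 𝓧} (hA : A.IsSymmetric) {M : ℕ}
    (w : Fin (M + 1) → 𝓧 × ℝ) (σ : Equiv.Perm (Fin (M + 1))) (k : Fin (M + 1)) :
    A.looResidual (w ∘ σ) k = A.looResidual w (σ k) := by
  have h : A.looModel (w ∘ σ) k = A.looModel w (σ k) := by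
    rw [hA.looModel_eq w (h := σ ∘ k.succAbove)
      (σ.injective.comp Fin.succAbove_right_injective)]
    · rfl
    · rw [Set.range_comp, Fin.range_succAbove, Set.image_compl_eq σ.bijective, Set.image_singleton]
  simp only [looResidual, h, Function.comp_apply]

lemma measurable_fit_comp (A : RegressionAlgorithm 𝓧) {Ω : Type*} [MeasurableSpace Ω] {n : ℕ}
    {d : Ω → Fin n → 𝓧 × ℝ} {x : Ω → 𝓧} (hd : Measurable d) (hx : Measurable x) :
    Measurable fun ω => A.fit n (d ω) (x ω) :=
  (A.measurable_fit n).comp (hd.prodMk hx)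

lemma measurable_leaveOneOut {Z : Type*} [MeasurableSpace Z] {n : ℕ} (i : Fin n) :
    Measurable fun d : Fin n → Z => leaveOneOut d i := by
  cases n with
  | zero => exact i.elim0
  | succ n => exact measurable_pi_lambda _ fun j => measurable_pi_apply (i.succAbove j)

lemma measurable_looModel (A : RegressionAlgorithm 𝓧) {Ω : Type*} [MeasurableSpace Ω] {n : ℕ}
    {d : Ω → Fin n → 𝓧 × ℝ} {x : Ω → 𝓧} (hd : Measurable d) (hx : Measurable x) (i : Fin n) :
    Measurable fun ω => A.looModel (d ω) i (x ω) :=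
  A.measurable_fit_comp ((measurable_leaveOneOut i).comp hd) hx

lemma measurable_looResidual (A : RegressionAlgorithm 𝓧) {n : ℕ} (i : Fin n) :
    Measurable fun d : Fin n → 𝓧 × ℝ => A.looResidual d i :=
  ((measurable_snd.comp (measurable_pi_apply i)).sub
    (A.measurable_looModel measurable_id (measurable_fst.comp (measurable_pi_apply i)) i)).abs

/-- The stability coefficient, with the points spread over a larger sample: `g` selects the
smaller training set and `k` the test point. -/
lemma IsSymmetric.lintegral_fit_sub_looModel {A : RegressionAlgorithm 𝓧} (hA : A.IsSymmetric)
    (P : Measure (𝓧 × ℝ)) [SigmaFinite P] {n m : ℕ} {g : Fin n → Fin (n + m + 1)}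
    (hg : g.Injective) {k : Fin (n + m + 1)} (hk : ∀ i, g i ≠ k) :
    ∫⁻ w : Fin (n + m + 1) → 𝓧 × ℝ,
      ENNReal.ofReal |A.fit n (w ∘ g) (w k).1 - A.looModel w k (w k).1|
      ∂(Measure.pi fun _ => P) = A.outStability P m n := by
  -- Reorder so that the test point `k` comes first and the points selected by `g` come next, as in
  -- the definition of `outStability`.
  obtain ⟨σ, hσ0, hσ⟩ : ∃ σ : Equiv.Perm (Fin (n + m + 1)), σ 0 = k ∧
      ∀ i : Fin n, σ (Fin.castAdd m i).succ = g i := by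
    let c : Fin (n + 1) → Fin (n + m + 1) := Fin.cons k g
    have hc : c.Injective := Fin.cons_injective_iff.2 ⟨fun ⟨i, hi⟩ => hk i hi, hg⟩
    let f : Fin (n + m + 1) → Fin (n + m + 1) := fun i => if h : i.val < n + 1 then c ⟨i, h⟩ else 0
    obtain ⟨τ, hτ⟩ := Finset.exists_equiv_extend_of_card_eq (α := Fin (n + m + 1))
      (t := (Finset.univ : Finset (Fin (n + m + 1)))) (by simp)
      (s := Finset.univ.filter fun i => i.val < n + 1) (f := f) (Finset.subset_univ _) (by
        intro i hi j hj hij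
        simp only [Finset.coe_filter, Finset.mem_univ, true_and, Set.mem_ofPred_eq] at hi hj
        simp only [f, hi, hj, dif_pos] at hij
        have := hc hij
        simpa [Fin.ext_iff] using this)
    refine ⟨τ.trans (Equiv.subtypeUnivEquiv (by simp)), ?_, fun i => ?_⟩
    · have := hτ 0 (by simp)
      simpa [f, c] using this
    · have := hτ (Fin.castAdd m i).succ (by simp)
      refine this.trans ?_
      simp only [f, Fin.val_succ, Fin.val_castAdd, Nat.add_lt_add_iff_right, i.isLt, dif_pos]
      exact Fin.cons_succ (α := fun _ => Fin (n + m + 1)) k g i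
  have hrange : Set.range (σ ∘ Fin.succ) = {k}ᶜ := by
    rw [Set.range_comp, Fin.range_succ, Set.image_compl_eq σ.bijective, Set.image_singleton, hσ0]
  have hmodel : ∀ w : Fin (n + m + 1) → 𝓧 × ℝ,
      A.looModel w k = A.fit (n + m) (w ∘ σ ∘ Fin.succ) := fun w =>
    hA.looModel_eq w (σ.injective.comp (Fin.succ_injective _)) hrange
  have hpre := measurePreserving_comp_succ P σ
  rw [outStability, ← hpre.lintegral_comp]
  · refine lintegral_congr fun w => ?_
    rw [hmodel, hσ0]
    have : w ∘ g = fun i => (w ∘ σ ∘ Fin.succ) (Fin.castAdd m i) := by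
      funext i
      simp [hσ]
    rw [this]
  · refine ENNReal.measurable_ofReal.comp (Measurable.abs (Measurable.sub ?_ ?_))
    · exact A.measurable_fit_comp (measurable_pi_lambda _ fun i =>
        (measurable_pi_apply _).comp measurable_fst) (measurable_fst.comp measurable_snd)
    · exact A.measurable_fit_comp measurable_fst (measurable_fst.comp measurable_snd)

end RegressionAlgorithm

/-! ### Empirical quantiles -/

lemma le_empiricalQuantile_iff {n : ℕ} (v : Fin n → ℝ) (τ y : ℝ) :
    (y : EReal) ≤ empiricalQuantile v τ ↔
      ((Finset.univ.filter fun i => v i < y).card : ℝ) / n < τ := by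
  rw [empiricalQuantile, le_sInf_iff]
  simp only [Set.forall_mem_image, Set.mem_ofPred_eq, EReal.coe_le_coe_iff]
  constructor
  · intro h
    -- With finitely many values there is room strictly below `y` and above all `v i < y`; at such a
    -- `t` the count already equals the strict count at `y`.
    obtain ⟨t, hty, ht⟩ : ∃ t < y, ∀ i, v i < y → v i ≤ t := by
      have h2 : ∀ᶠ t in nhdsWithin y (Set.Iio y), ∀ i, v i < y → v i ≤ t := by
        rw [Filter.eventually_all]
        intro i
        by_cases hi : v i < y
        · filter_upwards [Ioo_mem_nhdsLT hi] with t ht _ using ht.1.le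
        · simp [hi]
      obtain ⟨t, h3, h4⟩ := (h2.and self_mem_nhdsWithin).exists
      exact ⟨t, h4, h3⟩
    by_contra hτ
    rw [not_lt] at hτ
    refine absurd (h (hτ.trans ?_)) (not_le.2 hty)
    gcongr with i
    exact ht i
  · intro h t ht
    by_contra hty
    rw [not_le] at hty
    refine absurd (ht.trans ?_) (not_le.2 h)
    gcongr with i

namespace RegressionAlgorithm

variable {𝓧 : Type*} [MeasurableSpace 𝓧]

lemma mem_jackknifePlus_iff (A : RegressionAlgorithm 𝓧) (α : ℝ) {n : ℕ} (d : Fin n → 𝓧 × ℝ)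
    (x : 𝓧) (y : ℝ) : y ∈ A.jackknifePlus α d x ↔
      ((Finset.univ.filter fun i => -A.looModel d i x + A.looResidual d i < -y).card : ℝ) / n
        < (1 - α) * (1 + 1 / (n : ℝ)) ∧
      ((Finset.univ.filter fun i => A.looModel d i x + A.looResidual d i < y).card : ℝ) / n
        < (1 - α) * (1 + 1 / (n : ℝ)) := by
  rw [jackknifePlus, Set.mem_ofPred_eq, ← le_empiricalQuantile_iff, ← le_empiricalQuantile_iff,
    EReal.coe_neg, EReal.neg_le]

end RegressionAlgorithm

/-! ### Conditional densities -/

/-- Disintegrate over `x`: a slice of length at most `c` has conditional probability at most `c`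
times the supremum of the density. -/
lemma measure_le_mul_densBound {𝓧 : Type*} [MeasurableSpace 𝓧] (P : Measure (𝓧 × ℝ))
    [IsFiniteMeasure P] {f : 𝓧 → ℝ → ℝ≥0∞} (hf : IsCondDensity P f) {E : Set (𝓧 × ℝ)}
    (hE : MeasurableSet E) {c : ℝ≥0∞} (hc : c ≠ ⊤)
    (hvol : ∀ x, volume {y : ℝ | (x, y) ∈ E} ≤ c) : P E ≤ c * densBound P f := by
  calc P E = (P.fst ⊗ₘ P.condKernel) E := by rw [Measure.disintegrate]
    _ = ∫⁻ x, P.condKernel x (Prod.mk x ⁻¹' E) ∂P.fst := Measure.compProd_apply hE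
    _ ≤ ∫⁻ x, c * ⨆ y : ℝ, f x y ∂P.fst := by
        refine lintegral_mono_ae ?_
        filter_upwards [hf.2] with x hx
        rw [hx, withDensity_apply _ (measurable_prodMk_left hE)]
        calc ∫⁻ y in Prod.mk x ⁻¹' E, f x y ≤ ∫⁻ _ in Prod.mk x ⁻¹' E, ⨆ y, f x y :=
              lintegral_mono fun y => le_iSup (f x) y
          _ = (⨆ y, f x y) * volume (Prod.mk x ⁻¹' E) := setLIntegral_const _ _
          _ ≤ (⨆ y, f x y) * c := by gcongr; exact hvol x
          _ = _ := mul_comm _ _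
    _ = c * densBound P f := lintegral_const_mul' _ _ hc

/-- A zero bound would make every strip `|y| ≤ k` null. Nonvanishing lets the inflation radius be
obtained by dividing by the bound. -/
lemma densBound_ne_zero {𝓧 : Type*} [MeasurableSpace 𝓧] (P : Measure (𝓧 × ℝ))
    [IsProbabilityMeasure P] {f : 𝓧 → ℝ → ℝ≥0∞} (hf : IsCondDensity P f) : densBound P f ≠ 0 := by
  intro h0
  have h : ∀ k : ℕ, P (Prod.snd ⁻¹' Set.Icc (-(k : ℝ)) k) = 0 := fun k => by
    have := measure_le_mul_densBound P hf (measurable_snd (measurableSet_Icc (a := -(k : ℝ))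
      (b := k))) (c := volume (Set.Icc (-(k : ℝ)) k)) (by simp) (fun x => le_rfl)
    simpa [h0] using this
  have h1 : (⋃ k : ℕ, (Prod.snd ⁻¹' Set.Icc (-(k : ℝ)) k : Set (𝓧 × ℝ))) = Set.univ := by
    refine Set.eq_univ_of_forall fun z => ?_
    obtain ⟨k, hk⟩ := exists_nat_ge |z.2|
    exact Set.mem_iUnion.2 ⟨k, abs_le.1 hk⟩
  have h2 := measure_iUnion_null h
  rw [h1, measure_univ] at h2
  exact one_ne_zero h2

lemma volume_le_of_forall_sub_le {s : Set ℝ} {c : ℝ} (h : ∀ x ∈ s, ∀ y ∈ s, y - x ≤ c) :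
    volume s ≤ ENNReal.ofReal c := by
  refine (Real.volume_le_diam s).trans (Metric.ediam_le fun x hx y hy => ?_)
  rw [edist_dist, Real.dist_eq]
  refine ENNReal.ofReal_le_ofReal (abs_le.2 ⟨?_, h y hy x hx⟩)
  linarith [h x hx y hy]

/-! ### Hoeffding's inequality for exchangeable events and for independent samples -/

/-- Hoeffding's inequality for sampling without replacement: at most a fraction `p` of the
exchangeable events `W k` occur, and one counts those with index in the range of `a`. -/
lemma measureReal_card_ge_le_exp_of_equivariant {Z κ : Type*} [MeasurableSpace Z] [Fintype κ]
    {N : ℕ} (P : Measure Z) [IsProbabilityMeasure P] (W : Fin N → (Fin N → Z) → Prop)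
    [∀ k w, Decidable (W k w)] (hW : ∀ k, MeasurableSet {w | W k w})
    (hequiv : ∀ (σ : Equiv.Perm (Fin N)) w k, W k (w ∘ σ) ↔ W (σ k) w)
    {p : ℝ} (hp0 : 0 ≤ p) (hp1 : p ≤ 1)
    (hcard : ∀ w, ((Finset.univ.filter fun k => W k w).card : ℝ) ≤ p * N)
    (a : κ ↪ Fin N) {e : ℝ} (he : 0 ≤ e) :
    (Measure.pi fun _ : Fin N => P).real
      {w | Fintype.card κ * (p + e) ≤ ((Finset.univ.filter fun i => W (a i) w).card : ℝ)}
      ≤ Real.exp (-2 * Fintype.card κ * e ^ 2) := by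
  classical
  have hjoint := measureReal_biInter_le_pow (Measure.pi fun _ : Fin N => P)
    (fun k => {w | W k w}) hW hp1 (by simpa using hcard) (by
      intro S k k' hk hk'
      let σ := Equiv.swap k k'
      have hmp := measurePreserving_comp_equiv P σ
      have hm : MeasurableSet (⋂ i ∈ insert k S, {w : Fin N → Z | W i w}) :=
        Finset.measurableSet_biInter _ fun i _ => hW i
      rw [measureReal_def, measureReal_def, ← hmp.measure_preimage hm.nullMeasurableSet]
      congr 2
      ext w
      simp only [Set.mem_preimage, Set.mem_iInter, Finset.mem_insert, Set.mem_ofPred_eq, hequiv,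
        forall_eq_or_imp, σ, Equiv.swap_apply_left]
      refine and_congr_right fun _ => forall₂_congr fun i hi => ?_
      rw [Equiv.swap_apply_of_ne_of_ne] <;> rintro rfl <;> contradiction)
  have h := measureReal_card_ge_le_exp (Measure.pi fun _ : Fin N => P) (Finset.univ : Finset κ)
    (fun i => {w | W (a i) w}) (fun i => hW (a i)) hp0 hp1 (fun S _ => by
      simpa using hjoint (S.map a)) he
  simpa using h

/-- Hoeffding's inequality for the number of points of an i.i.d. sample in a set. -/
lemma measureReal_pi_card_ge_le_exp {Z κ : Type*} [MeasurableSpace Z] [Fintype κ]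
    (P : Measure Z) [IsProbabilityMeasure P] (V : Z → Prop) [DecidablePred V]
    (hV : MeasurableSet {z | V z}) {e : ℝ} (he : 0 ≤ e) :
    (Measure.pi fun _ : κ => P).real
      {z | Fintype.card κ * (P.real {z | V z} + e)
        ≤ ((Finset.univ.filter fun j => V (z j)).card : ℝ)}
      ≤ Real.exp (-2 * Fintype.card κ * e ^ 2) := by
  classical
  have h := measureReal_card_ge_le_exp (Measure.pi fun _ : κ => P) (Finset.univ : Finset κ)
    (fun j => {z | V (z j)}) (fun j => measurable_pi_apply j hV) measureReal_nonneg
    (measureReal_le_one (μ := P) (s := {z | V z})) (fun S _ => by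
      have h1 : (⋂ j ∈ S, {z : κ → Z | V (z j)}) =
          Set.univ.pi fun j => if j ∈ S then {z | V z} else Set.univ := by
        ext z
        simp only [Set.mem_iInter, Set.mem_ofPred_eq, Set.mem_pi, Set.mem_univ, true_imp_iff]
        refine forall_congr' fun j => ?_
        split_ifs with hj <;> simp [hj]
      rw [h1, measureReal_def, Measure.pi_pi, ENNReal.toReal_prod]
      simp only [apply_ite P, measure_univ, apply_ite ENNReal.toReal, ENNReal.toReal_one]
      rw [Finset.prod_ite_mem, Finset.univ_inter, Finset.prod_const, measureReal_def]) he
  simpa using h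

/-! ### Ranks -/

lemma cast_card_filter_le_of_imp {ι : Type*} [Fintype ι] {p q : ι → Prop} [DecidablePred p]
    [DecidablePred q] (h : ∀ i, p i → q i) :
    ((Finset.univ.filter p).card : ℝ) ≤ ((Finset.univ.filter q).card : ℝ) := by
  exact_mod_cast Finset.card_le_card (Finset.monotone_filter_right _ fun i _ => h i)

/-- The member of the set with the largest `r` counts all other members in its own rank. -/
lemma card_filter_rank_lt_le {ι : Type*} [Fintype ι] (r : ι → ℝ) {c : ℝ} (hc : 0 ≤ c) :
    ((Finset.univ.filter fun k =>
      ((Finset.univ.filter fun l => r l ≤ r k).card : ℝ) < c).card : ℝ) ≤ c := by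
  set S := Finset.univ.filter fun k => ((Finset.univ.filter fun l => r l ≤ r k).card : ℝ) < c
    with hS
  rcases S.eq_empty_or_nonempty with h | h
  · simpa [h] using hc
  · obtain ⟨k, hk, hmax⟩ := S.exists_max_image r h
    have hk' : ((Finset.univ.filter fun l => r l ≤ r k).card : ℝ) < c := by
      simpa [hS] using hk
    refine le_trans ?_ hk'.le
    exact_mod_cast Finset.card_le_card fun l hl => by simpa using hmax l hl

/-- The member of the set with the smallest `r` has at least `c` indices strictly below it, all
outside the set. -/
lemma card_filter_le_rank_le {ι : Type*} [Fintype ι] (r : ι → ℝ) {c : ℝ}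
    (hc : c ≤ Fintype.card ι) :
    ((Finset.univ.filter fun k =>
      c ≤ ((Finset.univ.filter fun l => r l < r k).card : ℝ)).card : ℝ)
      ≤ Fintype.card ι - c := by
  classical
  set S := Finset.univ.filter fun k => c ≤ ((Finset.univ.filter fun l => r l < r k).card : ℝ)
    with hS
  rcases S.eq_empty_or_nonempty with h | h
  · simpa [h] using hc
  · obtain ⟨k, hk, hmin⟩ := S.exists_min_image r h
    have hk' : c ≤ ((Finset.univ.filter fun l => r l < r k).card : ℝ) := by
      simpa [hS] using hk
    have h1 : Disjoint S (Finset.univ.filter fun l => r l < r k) :=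
      Finset.disjoint_left.2 fun l hl hl' => not_lt.2 (hmin l hl) (by simpa using hl')
    have h2 : S.card + (Finset.univ.filter fun l => r l < r k).card ≤ Fintype.card ι := by
      rw [← Finset.card_union_of_disjoint h1]
      exact Finset.card_le_univ _
    have h3 : (S.card : ℝ) + ((Finset.univ.filter fun l => r l < r k).card : ℝ)
        ≤ Fintype.card ι := by exact_mod_cast h2
    linarith

/-- Few columns `j` of the relation `G` have many entries, if `G i j` mostly implies
`r (a i) < r (b j)`, few of the `r (a i)` are among the smallest values of `r`, and few of the
`r (b j)` are among the largest. -/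
lemma card_filter_le_card_lt {ι κ κ' : Type*} [Fintype ι] [Fintype κ] [Fintype κ'] (r : ι → ℝ)
    (a : κ → ι) (b : κ' → ι) (G : κ → κ' → Prop) [∀ i j, Decidable (G i j)] {c u s v q : ℝ}
    (hs : 0 ≤ s) (hκ : 0 < Fintype.card κ) (hu : Fintype.card κ * (u + s) ≤ q)
    (ha : ((Finset.univ.filter fun i =>
      ((Finset.univ.filter fun l => r l ≤ r (a i)).card : ℝ) < c).card : ℝ) < Fintype.card κ * u)
    (hb : ((Finset.univ.filter fun j =>
      c ≤ ((Finset.univ.filter fun l => r l < r (b j)).card : ℝ)).card : ℝ)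
      < Fintype.card κ' * v)
    (hbad : ((Finset.univ.filter fun x : κ × κ' => G x.1 x.2 ∧ r (b x.2) ≤ r (a x.1)).card : ℝ)
      ≤ 2 * s ^ 2 * (Fintype.card κ * Fintype.card κ')) :
    ((Finset.univ.filter fun j =>
      q ≤ ((Finset.univ.filter fun i => G i j).card : ℝ)).card : ℝ)
      < Fintype.card κ' * (v + 2 * s) := by
  classical
  let D : κ' → ℕ := fun j => (Finset.univ.filter fun i => G i j ∧ r (b j) ≤ r (a i)).card
  have hκ' : (0 : ℝ) < Fintype.card κ := by exact_mod_cast hκ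
  have hDsum : (∑ j, (D j : ℝ)) ≤ 2 * s ^ 2 * (Fintype.card κ * Fintype.card κ') := by
    refine le_of_eq_of_le ?_ hbad
    simp only [D, Finset.card_filter, Nat.cast_sum, Fintype.sum_prod_type_right]
  -- Markov for counting: there are at most `2 s ^ 2 |κ| |κ'|` bad pairs, so few columns hold more
  -- than `s |κ|` of them.
  have hD : ((Finset.univ.filter fun j => s * Fintype.card κ < (D j : ℝ)).card : ℝ)
      ≤ 2 * s * Fintype.card κ' := by
    rcases hs.eq_or_lt with rfl | hs
    · have h0 : ∀ j, (D j : ℝ) = 0 := by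
        have h1 : (∑ j, (D j : ℝ)) = 0 := le_antisymm (by simpa using hDsum) (by positivity)
        intro j
        exact (Finset.sum_eq_zero_iff_of_nonneg fun j _ => Nat.cast_nonneg _).1 h1 j
          (Finset.mem_univ j)
      simp [h0]
    · have h1 : ((Finset.univ.filter fun j => s * Fintype.card κ < (D j : ℝ)).card : ℝ)
          * (s * Fintype.card κ) ≤ ∑ j, (D j : ℝ) := by
        rw [← nsmul_eq_mul]
        refine (Finset.card_nsmul_le_sum _ (fun j => (D j : ℝ)) _ fun j hj => ?_).trans
          (Finset.sum_le_sum_of_subset_of_nonneg (Finset.filter_subset _ _)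
            fun j _ _ => Nat.cast_nonneg _)
        exact (Finset.mem_filter.1 hj).2.le
      refine le_of_mul_le_mul_right (h1.trans (hDsum.trans (le_of_eq ?_)))
        (mul_pos hs hκ')
      ring
  -- If `b j` has rank below `c`, then so has every `a i` with `r (a i) < r (b j)`. There are fewer
  -- than `|κ| u` of these, so reaching `q ≥ |κ| (u + s)` takes more than `s |κ|` bad entries.
  have hsub : (Finset.univ.filter fun j =>
      q ≤ ((Finset.univ.filter fun i => G i j).card : ℝ)) ⊆
      (Finset.univ.filter fun j => c ≤ ((Finset.univ.filter fun l => r l < r (b j)).card : ℝ)) ∪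
      (Finset.univ.filter fun j => s * Fintype.card κ < (D j : ℝ)) := by
    intro j hj
    simp only [Finset.mem_union, Finset.mem_filter, Finset.mem_univ, true_and] at hj ⊢
    by_contra hcon
    rw [not_or, not_le, not_lt] at hcon
    have h1 : (Finset.univ.filter fun i => G i j) ⊆
        (Finset.univ.filter fun i =>
          ((Finset.univ.filter fun l => r l ≤ r (a i)).card : ℝ) < c) ∪
        (Finset.univ.filter fun i => G i j ∧ r (b j) ≤ r (a i)) := by
      intro i hi
      simp only [Finset.mem_union, Finset.mem_filter, Finset.mem_univ, true_and] at hi ⊢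
      by_cases hlt : r (a i) < r (b j)
      · refine Or.inl (lt_of_le_of_lt ?_ hcon.1)
        gcongr with l
      · exact Or.inr ⟨hi, not_lt.1 hlt⟩
    have h2 : ((Finset.univ.filter fun i => G i j).card : ℝ) ≤
        ((Finset.univ.filter fun i =>
          ((Finset.univ.filter fun l => r l ≤ r (a i)).card : ℝ) < c).card : ℝ) + D j := by
      exact_mod_cast (Finset.card_le_card h1).trans (Finset.card_union_le _ _)
    nlinarith [hcon.2]
  have h3 : ((Finset.univ.filter fun j =>
      q ≤ ((Finset.univ.filter fun i => G i j).card : ℝ)).card : ℝ) ≤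
      ((Finset.univ.filter fun j =>
        c ≤ ((Finset.univ.filter fun l => r l < r (b j)).card : ℝ)).card : ℝ) +
      ((Finset.univ.filter fun j => s * Fintype.card κ < (D j : ℝ)).card : ℝ) := by
    exact_mod_cast (Finset.card_le_card hsub).trans (Finset.card_union_le _ _)
  linarith

/-! ### The inflated interval -/

namespace RegressionAlgorithm

variable {𝓧 : Type*} [MeasurableSpace 𝓧]

/-- The test points at which at least `(1 - α) (n + 1)` of the leave-one-out models err by more
than the respective residual plus `γ`. They contain the points missed by the jackknife+ interval
inflated by `γ`. -/
def inflatedMiss (A : RegressionAlgorithm 𝓧) (α γ : ℝ) {n : ℕ} (d : Fin n → 𝓧 × ℝ) :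
    Set (𝓧 × ℝ) :=
  {z | (1 - α) * (n + 1) ≤ ((Finset.univ.filter fun i =>
    A.looResidual d i + γ < |z.2 - A.looModel d i z.1|).card : ℝ)}

lemma measurableSet_inflatedMiss (A : RegressionAlgorithm 𝓧) (α γ : ℝ) (n : ℕ) :
    MeasurableSet {q : (Fin n → 𝓧 × ℝ) × (𝓧 × ℝ) | q.2 ∈ A.inflatedMiss α γ q.1} := by
  refine measurableSet_le measurable_const (measurable_card_filter _ _ fun i => ?_)
  exact measurableSet_lt (((A.measurable_looResidual i).comp measurable_fst).add_const γ)
    ((measurable_snd.comp measurable_snd).sub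
      (A.measurable_looModel measurable_fst (measurable_fst.comp measurable_snd) i)).abs

/-- `U` and `L` collect the points missed at the upper and lower end that are no longer missed once
moved inwards by `γ`. The counts are monotone in `y`, so for each `x` their slices have diameter at
most `γ`. -/
lemma jackknifePlusMiscoverage_le (A : RegressionAlgorithm 𝓧) (P : Measure (𝓧 × ℝ))
    [IsProbabilityMeasure P] {f : 𝓧 → ℝ → ℝ≥0∞} (hf : IsCondDensity P f) (α : ℝ) {γ : ℝ}
    {n : ℕ} (hn : 1 ≤ n) (d : Fin n → 𝓧 × ℝ) :
    A.jackknifePlusMiscoverage P α d ≤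
      P (A.inflatedMiss α γ d) + 2 * (ENNReal.ofReal γ * densBound P f) := by
  have hn' : (0 : ℝ) < n := by exact_mod_cast hn
  have hlvl : ∀ c : ℝ, c / n < (1 - α) * (1 + 1 / (n : ℝ)) ↔ c < (1 - α) * (n + 1) := by
    intro c
    rw [div_lt_iff₀ hn']
    have : (1 - α) * (1 + 1 / (n : ℝ)) * n = (1 - α) * (n + 1) := by field_simp
    rw [this]
  have hμ := fun i => A.measurable_looModel (Ω := 𝓧 × ℝ) (measurable_const (a := d))
    measurable_fst i
  let U : Set (𝓧 × ℝ) := {z |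
    (1 - α) * (n + 1) ≤ ((Finset.univ.filter fun i =>
      A.looModel d i z.1 + A.looResidual d i < z.2).card : ℝ) ∧
    ((Finset.univ.filter fun i =>
      A.looModel d i z.1 + A.looResidual d i < z.2 - γ).card : ℝ) < (1 - α) * (n + 1)}
  let L : Set (𝓧 × ℝ) := {z |
    (1 - α) * (n + 1) ≤ ((Finset.univ.filter fun i =>
      -A.looModel d i z.1 + A.looResidual d i < -z.2).card : ℝ) ∧
    ((Finset.univ.filter fun i =>
      -A.looModel d i z.1 + A.looResidual d i < -z.2 - γ).card : ℝ) < (1 - α) * (n + 1)}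
  have hUm : MeasurableSet U := by
    refine MeasurableSet.inter ?_ ?_
    · exact measurableSet_le measurable_const (measurable_card_filter _ _ fun i =>
        measurableSet_lt ((hμ i).add_const _) measurable_snd)
    · exact measurableSet_lt (measurable_card_filter _ _ fun i =>
        measurableSet_lt ((hμ i).add_const _) (measurable_snd.sub_const _)) measurable_const
  have hU : P U ≤ ENNReal.ofReal γ * densBound P f := by
    refine measure_le_mul_densBound P hf hUm ENNReal.ofReal_ne_top
      fun x => volume_le_of_forall_sub_le fun y hy y' hy' => ?_
    by_contra hlt
    simp only [U, Set.mem_ofPred_eq] at hy hy'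
    refine absurd (hy.1.trans ?_) (not_le.2 hy'.2)
    exact cast_card_filter_le_of_imp fun i hi => lt_trans hi (by linarith)
  have hLm : MeasurableSet L := by
    refine MeasurableSet.inter ?_ ?_
    · exact measurableSet_le measurable_const (measurable_card_filter _ _ fun i =>
        measurableSet_lt ((hμ i).neg.add_const _) measurable_snd.neg)
    · exact measurableSet_lt (measurable_card_filter _ _ fun i =>
        measurableSet_lt ((hμ i).neg.add_const _) (measurable_snd.neg.sub_const _))
        measurable_const
  have hL : P L ≤ ENNReal.ofReal γ * densBound P f := by
    refine measure_le_mul_densBound P hf hLm ENNReal.ofReal_ne_top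
      fun x => volume_le_of_forall_sub_le fun y hy y' hy' => ?_
    by_contra hlt
    simp only [L, Set.mem_ofPred_eq] at hy hy'
    refine absurd (hy'.1.trans ?_) (not_le.2 hy.2)
    exact cast_card_filter_le_of_imp fun i hi => lt_trans hi (by linarith)
  have hsub : {z : 𝓧 × ℝ | z.2 ∉ A.jackknifePlus α d z.1} ⊆ A.inflatedMiss α γ d ∪ (U ∪ L) := by
    intro z hz
    rw [Set.mem_ofPred_eq, mem_jackknifePlus_iff, hlvl, hlvl, not_and_or, not_lt, not_lt] at hz
    by_cases hUL : z ∈ U ∪ L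
    · exact Or.inr hUL
    left
    simp only [Set.mem_union, U, L, Set.mem_ofPred_eq, not_or, not_and, not_lt] at hUL
    rcases hz with hz | hz
    · refine (hUL.2 hz).trans (cast_card_filter_le_of_imp fun i hi => ?_)
      rw [abs_sub_comm]
      exact lt_of_lt_of_le (by linarith) (le_abs_self _)
    · refine (hUL.1 hz).trans (cast_card_filter_le_of_imp fun i hi => ?_)
      exact lt_of_lt_of_le (by linarith) (le_abs_self _)
  calc A.jackknifePlusMiscoverage P α d ≤ P (A.inflatedMiss α γ d ∪ (U ∪ L)) := measure_mono hsub
    _ ≤ P (A.inflatedMiss α γ d) + (P U + P L) :=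
        (measure_union_le _ _).trans (by gcongr; exact measure_union_le _ _)
    _ ≤ _ := by rw [two_mul]; gcongr

end RegressionAlgorithm

/-! ### Overtaking is rare for a stable algorithm -/

namespace RegressionAlgorithm

variable {𝓧 : Type*} [MeasurableSpace 𝓧]

/-- The samples in which, by the `i`-th leave-one-out model of the subsample `a`, the point `k`
exceeds the residual of the `i`-th point of `a` by more than `γ`, although its leave-one-out
residual in the full sample is not larger. -/
def overtakeEvent (A : RegressionAlgorithm 𝓧) (γ : ℝ) {n N : ℕ} (a : Fin n → Fin N) (i : Fin n)
    (k : Fin N) : Set (Fin N → 𝓧 × ℝ) :=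
  {w | A.looResidual (w ∘ a) i + γ < |(w k).2 - A.looModel (w ∘ a) i (w k).1| ∧
    A.looResidual w k ≤ A.looResidual w (a i)}

lemma measurableSet_overtakeEvent (A : RegressionAlgorithm 𝓧) (γ : ℝ) {n N : ℕ}
    (a : Fin n → Fin N) (i : Fin n) (k : Fin N) : MeasurableSet (A.overtakeEvent γ a i k) := by
  have ha : Measurable fun w : Fin N → 𝓧 × ℝ => w ∘ a :=
    measurable_pi_lambda _ fun j => measurable_pi_apply (a j)
  refine MeasurableSet.inter ?_ ?_
  · exact measurableSet_lt (((A.measurable_looResidual i).comp ha).add_const γ)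
      ((measurable_snd.comp (measurable_pi_apply k)).sub
        (A.measurable_looModel ha (measurable_fst.comp (measurable_pi_apply k)) i)).abs
  · exact measurableSet_le (A.measurable_looResidual k) (A.measurable_looResidual (a i))

lemma IsSymmetric.measure_overtakeEvent_le {A : RegressionAlgorithm 𝓧} (hA : A.IsSymmetric)
    (P : Measure (𝓧 × ℝ)) [IsProbabilityMeasure P] {γ : ℝ} {n m : ℕ}
    {a : Fin (n + 1) → Fin (n + m + 1)} (ha : a.Injective) (i : Fin (n + 1))
    {k : Fin (n + m + 1)} (hk : ∀ j, a j ≠ k) {r : ℝ≥0∞}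
    (hr : 0 < γ ∧ 2 * A.outStability P m n ≤ ENNReal.ofReal γ * r ∨
      0 ≤ γ ∧ A.outStability P m n = 0) :
    (Measure.pi fun _ => P) (A.overtakeEvent γ a i k) ≤ r := by
  set μ := Measure.pi fun _ : Fin (n + m + 1) => P
  -- The training set of the `i`-th leave-one-out model; it avoids both `a i` and `k`, so both serve
  -- as test points.
  let g : Fin n → Fin (n + m + 1) := a ∘ i.succAbove
  have hg : g.Injective := ha.comp Fin.succAbove_right_injective
  have hgm : Measurable fun w : Fin (n + m + 1) → 𝓧 × ℝ => w ∘ g :=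
    measurable_pi_lambda _ fun j => measurable_pi_apply (g j)
  let Δ : Fin (n + m + 1) → (Fin (n + m + 1) → 𝓧 × ℝ) → ℝ := fun l w =>
    |A.fit n (w ∘ g) (w l).1 - A.looModel w l (w l).1|
  have hΔm : ∀ l, Measurable (Δ l) := fun l =>
    ((A.measurable_fit_comp hgm (measurable_fst.comp (measurable_pi_apply l))).sub
      (A.measurable_looModel measurable_id (measurable_fst.comp (measurable_pi_apply l)) l)).abs
  have hint : ∫⁻ w, (ENNReal.ofReal (Δ (a i) w) + ENNReal.ofReal (Δ k w)) ∂μ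
      = 2 * A.outStability P m n := by
    rw [lintegral_add_left (hΔm _).ennreal_ofReal, two_mul]
    congr 1
    · exact hA.lintegral_fit_sub_looModel P hg fun j hj =>
        Fin.succAbove_ne i j (ha hj)
    · exact hA.lintegral_fit_sub_looModel P hg fun j => hk _
  have hmeas : Measurable fun w => ENNReal.ofReal (Δ (a i) w) + ENNReal.ofReal (Δ k w) :=
    (ENNReal.measurable_ofReal.comp (hΔm _)).add (ENNReal.measurable_ofReal.comp (hΔm _))
  have hsub : ∀ w ∈ A.overtakeEvent γ a i k, γ < Δ (a i) w + Δ k w := by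
    rintro w ⟨h1, h2⟩
    have h3 : |(w k).2 - A.looModel (w ∘ a) i (w k).1| ≤ A.looResidual w k + Δ k w := by
      have := abs_sub_le (w k).2 (A.looModel w k (w k).1) (A.looModel (w ∘ a) i (w k).1)
      rw [abs_sub_comm (A.looModel w k (w k).1)] at this
      exact this
    have h4 : A.looResidual w (a i) ≤ A.looResidual (w ∘ a) i + Δ (a i) w :=
      abs_sub_le (w (a i)).2 (A.looModel (w ∘ a) i (w (a i)).1) (A.looModel w (a i) (w (a i)).1)
    linarith
  rcases hr with ⟨hγ, hr⟩ | ⟨hγ, hβ⟩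
  · have hγ' : ENNReal.ofReal γ ≠ 0 := by simpa using hγ
    have h := mul_meas_ge_le_lintegral (μ := μ) hmeas (ENNReal.ofReal γ)
    rw [hint] at h
    refine (measure_mono fun w hw => ?_).trans
      ((ENNReal.mul_le_mul_iff_right hγ' ENNReal.ofReal_ne_top).1 (h.trans hr))
    rw [Set.mem_ofPred_eq, ← ENNReal.ofReal_add (abs_nonneg _) (abs_nonneg _)]
    exact ENNReal.ofReal_le_ofReal (hsub w hw).le
  -- With perfect stability both differences vanish almost surely, and the strict inequality `γ < Δ
  -- + Δ` makes the event null even for `γ = 0`.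
  · rw [hβ, mul_zero, lintegral_eq_zero_iff hmeas] at hint
    refine le_of_eq_of_le (measure_mono_null (fun w hw => ?_) (ae_iff.1 hint)) zero_le
    have h5 := hγ.trans_lt (hsub w hw)
    rw [← ENNReal.ofReal_pos, ENNReal.ofReal_add (abs_nonneg _) (abs_nonneg _)] at h5
    exact h5.ne'

end RegressionAlgorithm

/-- Markov's inequality for the number of occurring events of probability at most `2 s ^ 3`. -/
lemma measureReal_lt_card_le {Ω ι : Type*} [MeasurableSpace Ω] [Fintype ι] (μ : Measure Ω)
    [IsProbabilityMeasure μ] (B : ι → Ω → Prop) [∀ i ω, Decidable (B i ω)]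
    (hB : ∀ i, MeasurableSet {ω | B i ω}) {s : ℝ} (hs : 0 ≤ s)
    (h : ∀ i, μ.real {ω | B i ω} ≤ 2 * s ^ 3) :
    μ.real {ω | 2 * s ^ 2 * Fintype.card ι < ((Finset.univ.filter fun i => B i ω).card : ℝ)}
      ≤ s := by
  classical
  have hX : ∀ ω, ((Finset.univ.filter fun i => B i ω).card : ℝ) =
      ∑ i, {ω | B i ω}.indicator (fun _ => (1 : ℝ)) ω := by
    intro ω
    simp [Set.indicator_apply]
  have hi : ∀ i, Integrable ({ω | B i ω}.indicator fun _ => (1 : ℝ)) μ := fun i =>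
    (integrable_const (1 : ℝ)).indicator (hB i)
  have hint : ∫ ω, ((Finset.univ.filter fun i => B i ω).card : ℝ) ∂μ
      ≤ Fintype.card ι * (2 * s ^ 3) := by
    simp_rw [hX]
    rw [integral_finsetSum _ fun i _ => hi i]
    calc ∑ i, ∫ ω, {ω | B i ω}.indicator (fun _ => (1 : ℝ)) ω ∂μ
        = ∑ i, μ.real {ω | B i ω} := by
          refine Finset.sum_congr rfl fun i _ => ?_
          rw [integral_indicator_const _ (hB i)]
          simp
      _ ≤ ∑ _i : ι, 2 * s ^ 3 := Finset.sum_le_sum fun i _ => h i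
      _ = _ := by simp
  have hXint : Integrable (fun ω => ((Finset.univ.filter fun i => B i ω).card : ℝ)) μ := by
    simp_rw [hX]
    exact integrable_finsetSum _ fun i _ => hi i
  have hnn : 0 ≤ᵐ[μ] fun ω => ((Finset.univ.filter fun i => B i ω).card : ℝ) :=
    Filter.Eventually.of_forall fun ω => Nat.cast_nonneg _
  rcases isEmpty_or_nonempty ι with hι | hι
  · simpa using hs
  have hι' : (0 : ℝ) < Fintype.card ι := by exact_mod_cast Fintype.card_pos
  rcases hs.eq_or_lt with rfl | hs
  · have h0 := (integral_eq_zero_iff_of_nonneg_ae hnn hXint).1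
      (le_antisymm (by simpa using hint) (integral_nonneg_of_ae hnn))
    refine le_of_eq ?_
    rw [measureReal_eq_zero_iff]
    refine measure_mono_null (fun ω hω => ?_) (ae_iff.1 h0)
    have hω' : (0 : ℝ) < ((Finset.univ.filter fun i => B i ω).card : ℝ) := by simpa using hω
    exact hω'.ne'
  · have hm := mul_meas_ge_le_integral_of_nonneg hnn hXint (2 * s ^ 2 * Fintype.card ι)
    have hpos : 0 < 2 * s ^ 2 * Fintype.card ι := by positivity
    refine le_of_mul_le_mul_left ?_ hpos
    calc _ ≤ 2 * s ^ 2 * Fintype.card ι *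
          μ.real {ω | 2 * s ^ 2 * Fintype.card ι
            ≤ ((Finset.univ.filter fun i => B i ω).card : ℝ)} := by
          refine mul_le_mul_of_nonneg_left (measureReal_mono (fun ω hω => ?_)
            (measure_ne_top _ _)) hpos.le
          rw [Set.mem_ofPred_eq] at hω ⊢
          exact hω.le
      _ ≤ Fintype.card ι * (2 * s ^ 3) := hm.trans hint
      _ = _ := by ring

/-! ### Miscoverage of the inflated interval -/

namespace RegressionAlgorithm

variable {𝓧 : Type*} [MeasurableSpace 𝓧]

/-- The probability that an independent point lies in `inflatedMiss` is rarely large. -/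
lemma IsSymmetric.measure_inflatedMiss_ge_le {A : RegressionAlgorithm 𝓧} (hA : A.IsSymmetric)
    (P : Measure (𝓧 × ℝ)) [IsProbabilityMeasure P] {α γ s e δ : ℝ} (hα : α ≤ 1) {n m : ℕ}
    (hα0 : 0 ≤ α) (hs : 0 ≤ s) (he : 0 ≤ e) (hle : α + s + e ≤ 1)
    (hδn : Real.exp (-2 * (n + 1 : ℕ) * e ^ 2) ≤ δ) (hδm : Real.exp (-2 * m * e ^ 2) ≤ δ)
    (hm : 1 ≤ m)
    (hbad : ∀ (a : Fin (n + 1) → Fin (n + m + 1)), a.Injective → ∀ i k, (∀ j, a j ≠ k) →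
      (Measure.pi fun _ => P).real (A.overtakeEvent γ a i k) ≤ 2 * s ^ 3) :
    (Measure.pi fun _ : Fin (n + 1) => P).real
      {d | α + 3 * s + 3 * e ≤ P.real (A.inflatedMiss α γ d)} ≤ 3 * δ + s := by
  classical
  let σ : Fin (n + 1) ⊕ Fin m ≃ Fin (n + m + 1) :=
    finSumFinEquiv.trans (finCongr (by omega))
  let a : Fin (n + 1) ↪ Fin (n + m + 1) := ⟨σ ∘ Sum.inl, σ.injective.comp Sum.inl_injective⟩
  let b : Fin m ↪ Fin (n + m + 1) := ⟨σ ∘ Sum.inr, σ.injective.comp Sum.inr_injective⟩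
  have hab : ∀ i j, a i ≠ b j := fun i j h => by
    have := σ.injective h
    simp at this
  set μ := Measure.pi fun _ : Fin (n + m + 1) => P
  have hsplit : MeasurePreserving (fun w : Fin (n + m + 1) → 𝓧 × ℝ => (w ∘ a, w ∘ b)) μ
      ((Measure.pi fun _ => P).prod (Measure.pi fun _ => P)) := measurePreserving_comp_sum P σ
  -- The rank cutoff leaves room, below `1 - α`, for the Hoeffding deviation `e` and for a fraction
  -- `s` of overtakings.
  set p : ℝ := 1 - α - s - e with hp
  let W : Fin (n + m + 1) → (Fin (n + m + 1) → 𝓧 × ℝ) → Prop := fun k w =>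
    ((Finset.univ.filter fun l => A.looResidual w l ≤ A.looResidual w k).card : ℝ) < p * (n + m + 1 : ℕ)
  let H : Fin (n + m + 1) → (Fin (n + m + 1) → 𝓧 × ℝ) → Prop := fun k w =>
    p * (n + m + 1 : ℕ) ≤ ((Finset.univ.filter fun l => A.looResidual w l < A.looResidual w k).card : ℝ)
  have hWm : ∀ k, MeasurableSet {w | W k w} := fun k =>
    measurableSet_lt (measurable_card_filter _ _ fun l =>
      measurableSet_le (A.measurable_looResidual l) (A.measurable_looResidual k)) measurable_const
  have hHm : ∀ k, MeasurableSet {w | H k w} := fun k =>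
    measurableSet_le measurable_const (measurable_card_filter _ _ fun l =>
      measurableSet_lt (A.measurable_looResidual l) (A.measurable_looResidual k))
  have hcomp : ∀ (τ : Equiv.Perm (Fin (n + m + 1))) (w : Fin (n + m + 1) → 𝓧 × ℝ) k,
      A.looResidual (w ∘ τ) k = A.looResidual w (τ k) := fun τ w k => hA.looResidual_comp w τ k
  have hperm : ∀ (τ : Equiv.Perm (Fin (n + m + 1))) (q : Fin (n + m + 1) → Prop) [DecidablePred q],
      (Finset.univ.filter fun l => q (τ l)).card = (Finset.univ.filter q).card := by
    intro τ q _
    refine Finset.card_bij (fun l _ => τ l) (by simp) (fun _ _ _ _ h => τ.injective h)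
      fun l hl => ⟨τ.symm l, by simpa using hl, by simp⟩
  have hWeq : ∀ (τ : Equiv.Perm (Fin (n + m + 1))) w k, W k (w ∘ τ) ↔ W (τ k) w := by
    intro τ w k
    simp only [W, hcomp]
    rw [hperm τ fun l => A.looResidual w l ≤ A.looResidual w (τ k)]
  have hHeq : ∀ (τ : Equiv.Perm (Fin (n + m + 1))) w k, H k (w ∘ τ) ↔ H (τ k) w := by
    intro τ w k
    simp only [H, hcomp]
    rw [hperm τ fun l => A.looResidual w l < A.looResidual w (τ k)]
  have hp0 : 0 ≤ p := by linarith
  have hp1 : p ≤ 1 := by linarith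
  have hW := measureReal_card_ge_le_exp_of_equivariant P W hWm hWeq hp0 hp1
    (fun w => card_filter_rank_lt_le (A.looResidual w) (by positivity)) a he
  have hH := measureReal_card_ge_le_exp_of_equivariant P H hHm hHeq (p := 1 - p) (by linarith)
    (by linarith) (fun w => (card_filter_le_rank_le (A.looResidual w) (c := p * (n + m + 1 : ℕ)) (by
      rw [Fintype.card_fin]
      exact mul_le_of_le_one_left (Nat.cast_nonneg _) hp1)).trans_eq (by
        rw [Fintype.card_fin]; ring)) b he
  rw [Fintype.card_fin] at hW hH
  have hover := measureReal_lt_card_le μ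
    (fun x : Fin (n + 1) × Fin m => fun w => w ∈ A.overtakeEvent γ a x.1 (b x.2))
    (fun x => A.measurableSet_overtakeEvent γ a x.1 (b x.2)) hs
    (fun x => hbad a a.injective x.1 (b x.2) fun j => hab j x.2)
  -- Counting the points that are not missed turns the needed lower bound on the missed fraction
  -- into an upper-tail event.
  let T : Set ((Fin (n + 1) → 𝓧 × ℝ) × (Fin m → 𝓧 × ℝ)) := {q |
    m * (P.real {z | z ∉ A.inflatedMiss α γ q.1} + e)
      ≤ ((Finset.univ.filter fun j => q.2 j ∉ A.inflatedMiss α γ q.1).card : ℝ)}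
  have hIm := A.measurableSet_inflatedMiss α γ (n + 1)
  have hIm' : ∀ d : Fin (n + 1) → 𝓧 × ℝ, MeasurableSet (A.inflatedMiss α γ d) := fun d =>
    measurable_prodMk_left hIm
  have hTm : MeasurableSet T := by
    refine measurableSet_le (((Measurable.ennreal_toReal
      (measurable_measure_prodMk_left hIm.compl)).comp measurable_fst).add_const e |>.const_mul _)
      (measurable_card_filter _ _ fun j => ?_)
    have : Measurable fun q : (Fin (n + 1) → 𝓧 × ℝ) × (Fin m → 𝓧 × ℝ) => (q.1, q.2 j) :=
      measurable_fst.prodMk ((measurable_pi_apply j).comp measurable_snd)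
    exact this hIm.compl
  have hT : μ.real ((fun w : Fin (n + m + 1) → 𝓧 × ℝ => (w ∘ a, w ∘ b)) ⁻¹' T) ≤ δ := by
    have hδ : 0 ≤ δ := (Real.exp_pos _).le.trans hδm
    rw [measureReal_def, hsplit.measure_preimage hTm.nullMeasurableSet, Measure.prod_apply hTm]
    refine ENNReal.toReal_le_of_le_ofReal hδ ?_
    calc ∫⁻ d, (Measure.pi fun _ => P) (Prod.mk d ⁻¹' T) ∂(Measure.pi fun _ => P)
        ≤ ∫⁻ _d : Fin (n + 1) → 𝓧 × ℝ, ENNReal.ofReal δ ∂(Measure.pi fun _ => P) := by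
          refine lintegral_mono fun d => ?_
          rw [← ofReal_measureReal]
          refine ENNReal.ofReal_le_ofReal (le_trans ?_ hδm)
          have := measureReal_pi_card_ge_le_exp (κ := Fin m) P
            (fun z => z ∉ A.inflatedMiss α γ d) (hIm' d).compl he
          rw [Fintype.card_fin] at this
          exact this
      _ = ENNReal.ofReal δ := by simp
  let D : Set (Fin (n + 1) → 𝓧 × ℝ) := {d | α + 3 * s + 3 * e ≤ P.real (A.inflatedMiss α γ d)}
  have hDm : MeasurableSet D :=
    measurableSet_le measurable_const (measurable_measure_prodMk_left hIm).ennreal_toReal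
  have hD : (Measure.pi fun _ : Fin (n + 1) => P).real D = μ.real {w | w ∘ a ∈ D} := by
    have h1 := measurePreserving_fst.comp hsplit
    rw [measureReal_def, measureReal_def, ← h1.measure_preimage hDm.nullMeasurableSet]
    rfl
  have hm' : (0 : ℝ) < m := by exact_mod_cast hm
  have hincl : {w | w ∘ a ∈ D} ⊆
      ({w | ((n + 1 : ℕ) : ℝ) * (p + e) ≤ ((Finset.univ.filter fun i => W (a i) w).card : ℝ)} ∪
      {w | (m : ℝ) * (1 - p + e) ≤ ((Finset.univ.filter fun j => H (b j) w).card : ℝ)}) ∪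
      ((fun w : Fin (n + m + 1) → 𝓧 × ℝ => (w ∘ a, w ∘ b)) ⁻¹' T ∪
      {w | 2 * s ^ 2 * Fintype.card (Fin (n + 1) × Fin m) < ((Finset.univ.filter
        fun x : Fin (n + 1) × Fin m => w ∈ A.overtakeEvent γ a x.1 (b x.2)).card : ℝ)}) := by
    intro w hw
    by_contra hcon
    simp only [Set.mem_union, Set.mem_ofPred_eq, not_or, not_le, not_lt, Set.mem_preimage, T]
      at hcon
    obtain ⟨⟨h1, h2⟩, h3, h4⟩ := hcon
    have hw' : α + 3 * s + 3 * e ≤ P.real (A.inflatedMiss α γ (w ∘ a)) := hw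
    -- Here `u + s = 1 - α`, so the required count `(n + 1)(1 - α)` is below the level `(1 - α)(n +
    -- 2)`.
    have hkey := card_filter_le_card_lt (A.looResidual w) a b
      (fun i j => A.looResidual (w ∘ a) i + γ < |(w (b j)).2 - A.looModel (w ∘ a) i (w (b j)).1|)
      (c := p * (n + m + 1 : ℕ)) (u := p + e) (s := s) (v := 1 - p + e) (q := (1 - α) * ((n + 1 : ℕ) + 1))
      hs (by simp) (by
        rw [Fintype.card_fin, hp]
        have : (0 : ℝ) ≤ ((n + 1 : ℕ) : ℝ) := Nat.cast_nonneg _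
        nlinarith) (by rw [Fintype.card_fin]; exact h1) (by rw [Fintype.card_fin]; exact h2) (by
        rw [Fintype.card_prod, Nat.cast_mul] at h4
        refine le_of_eq_of_le ?_ h4
        congr)
    rw [Fintype.card_fin] at hkey
    have hcount : ((Finset.univ.filter fun j => w (b j) ∈ A.inflatedMiss α γ (w ∘ a)).card : ℝ)
        < m * (1 - p + e + 2 * s) := by
      refine lt_of_eq_of_lt ?_ hkey
      congr
    have hcompl : ((Finset.univ.filter fun j => w (b j) ∈ A.inflatedMiss α γ (w ∘ a)).card : ℝ) +
        ((Finset.univ.filter fun j => w (b j) ∉ A.inflatedMiss α γ (w ∘ a)).card : ℝ) = m := by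
      have := Finset.card_filter_add_card_filter_not (s := (Finset.univ : Finset (Fin m)))
        (fun j => w (b j) ∈ A.inflatedMiss α γ (w ∘ a))
      rw [Finset.card_univ, Fintype.card_fin] at this
      exact_mod_cast this
    have hPc : P.real {z | z ∉ A.inflatedMiss α γ (w ∘ a)} =
        1 - P.real (A.inflatedMiss α γ (w ∘ a)) := probReal_compl_eq_one_sub (hIm' _)
    rw [hPc] at h3
    simp only [Function.comp_apply] at h3
    -- Missed and unmissed test points add up to `m`; cancelling `m` leaves miscoverage below `α +
    -- 3s + 3e`, contradicting `hw'`.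
    have h5 : (m : ℝ) * 1 < m * (1 - P.real (A.inflatedMiss α γ (w ∘ a)) + e +
      (1 - p + e + 2 * s)) := by linarith
    have h6 := lt_of_mul_lt_mul_left h5 hm'.le
    linarith
  calc (Measure.pi fun _ : Fin (n + 1) => P).real D = μ.real {w | w ∘ a ∈ D} := hD
    _ ≤ _ := measureReal_mono hincl
    _ ≤ _ := measureReal_union_le _ _
    _ ≤ (δ + δ) + (δ + s) := by
        refine add_le_add ((measureReal_union_le _ _).trans (add_le_add ?_ ?_))
          ((measureReal_union_le _ _).trans (add_le_add hT hover))
        · exact hW.trans hδn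
        · exact hH.trans hδm
    _ = 3 * δ + s := by ring

end RegressionAlgorithm

/-! ### Choice of the parameters and conclusion -/

lemma exp_neg_two_mul_sqrt_sq_le {δ k c : ℝ} (hδ : δ ∈ Set.Ioo (0 : ℝ) 1) (hc : 0 < c)
    (hk : c ≤ k) : Real.exp (-2 * k * √(Real.log (1 / δ) / (2 * c)) ^ 2) ≤ δ := by
  have hlog : 0 < Real.log (1 / δ) := Real.log_pos ((one_lt_div hδ.1).2 hδ.2)
  rw [Real.sq_sqrt (by positivity), ← Real.le_log_iff_exp_le hδ.1]
  have h1 : Real.log δ = -Real.log (1 / δ) := by rw [one_div, Real.log_inv, neg_neg]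
  rw [h1]
  have h2 : -2 * k * (Real.log (1 / δ) / (2 * c)) = -(k / c * Real.log (1 / δ)) := by
    field_simp
  rw [h2, neg_le_neg_iff]
  exact le_mul_of_one_le_left hlog.le ((one_le_div hc).2 hk)

/-- An inflation radius balancing the loss from the density against that from instability. -/
lemma exists_inflation_radius {B β : ℝ≥0∞} (hB : B ≠ 0)
    (hs : (2 * B * β) ^ (1 / 4 : ℝ) ≠ ⊤) :
    ∃ γ : ℝ, 2 * (ENNReal.ofReal γ * B) ≤ (2 * B * β) ^ (1 / 4 : ℝ) ∧
      (0 < γ ∧ 2 * β ≤ ENNReal.ofReal γ *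
        ENNReal.ofReal (2 * ((2 * B * β) ^ (1 / 4 : ℝ)).toReal ^ 3) ∨ 0 ≤ γ ∧ β = 0) := by
  by_cases hβ : β = 0
  -- No inflation is needed, so `B = ∞` does no harm: `0 * ∞ = 0`.
  · exact ⟨0, by simp, Or.inr ⟨le_rfl, hβ⟩⟩
  have hprod : 2 * B * β ≠ ⊤ := fun h => hs (by rw [h, ENNReal.top_rpow_of_pos (by norm_num)])
  have hβt : β ≠ ⊤ := fun h => hprod (by rw [h, ENNReal.mul_top (by simp [hB])])
  have hBt : B ≠ ⊤ := fun h => hprod (by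
    rw [h, ENNReal.mul_top (by simp), ENNReal.top_mul hβ])
  lift B to NNReal using hBt
  lift β to NNReal using hβt
  have hB' : (0 : ℝ) < B := by
    have : B ≠ 0 := by simpa using hB
    exact_mod_cast pos_iff_ne_zero.2 this
  have hβ' : (0 : ℝ) < β := by
    have : β ≠ 0 := by simpa using hβ
    exact_mod_cast pos_iff_ne_zero.2 this
  set s : ℝ := ((2 * (B : ℝ≥0∞) * β) ^ (1 / 4 : ℝ)).toReal with hs_def
  have hs_eq : s = (2 * (B : ℝ) * β) ^ (1 / 4 : ℝ) := by
    rw [hs_def, ← ENNReal.toReal_rpow]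
    simp
  have hs0 : 0 < s := by rw [hs_eq]; positivity
  have hs4 : s ^ 4 = 2 * (B : ℝ) * β := by
    rw [hs_eq, ← Real.rpow_natCast, ← Real.rpow_mul (by positivity)]
    norm_num
  -- Solves `2γB = s`; then `2β/γ = 4Bβ/s = 2 s ^ 3`.
  refine ⟨s / (2 * B), ?_, Or.inl ⟨by positivity, ?_⟩⟩
  · rw [← ENNReal.ofReal_toReal hs, ← hs_def, ← ENNReal.ofReal_coe_nnreal (p := B),
      ← ENNReal.ofReal_mul (by positivity), ← ENNReal.ofReal_ofNat 2,
      ← ENNReal.ofReal_mul (by norm_num)]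
    refine ENNReal.ofReal_le_ofReal (le_of_eq ?_)
    field_simp
  · rw [← ENNReal.ofReal_mul (by positivity), ← ENNReal.ofReal_coe_nnreal (p := β),
      ← ENNReal.ofReal_ofNat 2, ← ENNReal.ofReal_mul (by norm_num)]
    refine ENNReal.ofReal_le_ofReal (le_of_eq ?_)
    field_simp
    linarith

theorem theorem2 {𝓧 : Type*} [MeasurableSpace 𝓧]
    (P : Measure (𝓧 × ℝ)) [IsProbabilityMeasure P]
    (A : RegressionAlgorithm 𝓧) (hA : A.IsSymmetric)
    (f : 𝓧 → ℝ → ℝ≥0∞) (hf : IsCondDensity P f)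
    (α : ℝ) (hα : α ∈ Set.Icc (0 : ℝ) 1)
    (n : ℕ) (hn : 1 ≤ n) (m : ℕ) (hm : 1 ≤ m)
    (δ : ℝ) (hδ : δ ∈ Set.Ioo (0 : ℝ) 1) :
    1 - ENNReal.ofReal (3 * δ)
        - (2 * densBound P f * A.outStability P m (n - 1)) ^ (1 / 4 : ℝ) ≤
      (Measure.pi fun _ : Fin n => P)
        {d : Fin n → 𝓧 × ℝ |
          A.jackknifePlusMiscoverage P α d <
            ENNReal.ofReal (α + 3 * √(Real.log (1 / δ) / (2 * min (n : ℝ) (m : ℝ))))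
              + 4 * (2 * densBound P f * A.outStability P m (n - 1)) ^ (1 / 4 : ℝ)} := by
  obtain ⟨n, rfl⟩ : ∃ k, n = k + 1 := ⟨n - 1, by omega⟩
  rw [Nat.add_sub_cancel]
  set t := (2 * densBound P f * A.outStability P m n) ^ (1 / 4 : ℝ) with ht
  set e := √(Real.log (1 / δ) / (2 * min ((n + 1 : ℕ) : ℝ) (m : ℝ))) with he_def
  set μ := Measure.pi fun _ : Fin (n + 1) => P with hμ
  have he : 0 ≤ e := Real.sqrt_nonneg _
  have hα0 := hα.1
  rcases le_or_gt 1 t with ht1 | ht1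
  -- The lower bound is truncated to zero.
  · rw [tsub_eq_zero_of_le (tsub_le_self.trans ht1)]
    exact zero_le
  have htop : t ≠ ⊤ := ne_top_of_lt ht1
  set s := t.toReal with hs_def
  have hts : t = ENNReal.ofReal s := (ENNReal.ofReal_toReal htop).symm
  have hs : 0 ≤ s := ENNReal.toReal_nonneg
  have hbound : ENNReal.ofReal (α + 3 * e) + 4 * t = ENNReal.ofReal (α + 3 * s + 3 * e) + t := by
    rw [hts, ← ENNReal.ofReal_ofNat 4, ← ENNReal.ofReal_mul (by norm_num),
      ← ENNReal.ofReal_add (by positivity) (by positivity),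
      ← ENNReal.ofReal_add (by positivity) hs]
    congr 1
    ring
  rw [hbound]
  -- Above `1` every data set qualifies; otherwise the rank cutoff `1 - α - s - e` is nonnegative.
  rcases lt_or_ge 1 (α + 3 * s + 3 * e) with h1 | h1
  · have huniv : {d : Fin (n + 1) → 𝓧 × ℝ | A.jackknifePlusMiscoverage P α d <
        ENNReal.ofReal (α + 3 * s + 3 * e) + t} = Set.univ := by
      refine Set.eq_univ_of_forall fun d => ?_
      refine lt_of_le_of_lt (prob_le_one (μ := P)) (lt_of_lt_of_le ?_ le_self_add)
      rwa [ENNReal.one_lt_ofReal]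
    rw [huniv, measure_univ]
    exact tsub_le_self.trans tsub_le_self
  obtain ⟨γ, hγB, hγ⟩ := exists_inflation_radius (densBound_ne_zero P hf) htop
  rw [← ht, ← hs_def] at hγ
  rw [← ht] at hγB
  have hmin : (0 : ℝ) < min ((n + 1 : ℕ) : ℝ) (m : ℝ) :=
    lt_min (by exact_mod_cast hn) (by exact_mod_cast hm)
  have hrare := hA.measure_inflatedMiss_ge_le P (γ := γ) hα.2 hα0 hs he (by linarith)
    (exp_neg_two_mul_sqrt_sq_le hδ hmin (min_le_left _ _))
    (exp_neg_two_mul_sqrt_sq_le hδ hmin (min_le_right _ _)) hm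
    (fun a ha i k hk => ENNReal.toReal_le_of_le_ofReal (by positivity)
      (hA.measure_overtakeEvent_le P ha i hk hγ))
  have hcover : (Set.univ : Set (Fin (n + 1) → 𝓧 × ℝ)) ⊆
      {d | A.jackknifePlusMiscoverage P α d < ENNReal.ofReal (α + 3 * s + 3 * e) + t} ∪
      {d | α + 3 * s + 3 * e ≤ P.real (A.inflatedMiss α γ d)} := by
    intro d _
    rcases le_or_gt (α + 3 * s + 3 * e) (P.real (A.inflatedMiss α γ d)) with hd | hd
    · exact Or.inr hd
    refine Or.inl ?_
    have hlt : P (A.inflatedMiss α γ d) < ENNReal.ofReal (α + 3 * s + 3 * e) := by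
      rw [← ofReal_measureReal]
      exact (ENNReal.ofReal_lt_ofReal_iff_of_nonneg measureReal_nonneg).2 hd
    exact (A.jackknifePlusMiscoverage_le P hf α (Nat.le_add_left 1 n) d).trans_lt
      (ENNReal.add_lt_add_of_lt_of_le (ne_top_of_le_ne_top htop hγB) hlt hγB)
  rw [tsub_tsub, tsub_le_iff_right, ← measure_univ (μ := μ)]
  refine (measure_mono hcover).trans ((measure_union_le _ _).trans ?_)
  gcongr
  rw [hts, ← ENNReal.ofReal_add (by linarith [hδ.1]) hs, ← ofReal_measureReal]
  exact ENNReal.ofReal_le_ofReal hrare
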